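/- Let $n\ge 0$ be an integer and let $H\subset\mathbb{Z}^n\subset\mathbb{R}^n$ be a finite set. For $x\in\mathbb{R}^n$ write $\mathcal{A}_H(x)=(\operatorname{sign}\langle h,x\rangle : h\in H)\in\{-,0,+\}^H$, where $\langle\cdot,\cdot\rangle$ is the standard inner product. A \emph{comparison decision tree} for $H$ is a (finite, deterministic) ternary decision tree with input $x\in\mathbb{R}^n$, each of whose inner nodes queries $\operatorname{sign}\langle v,x\rangle\in\{-,0,+\}$ for a vector $v$ that either lies in $H$ (a label query) or has the form $v=h'-h''$ with $h',h''\in H$ (a comparison query), and branches according to the answer. It computes $\mathcal{A}_H$ if for every $x\in\mathbb{R}^n$ the leaf reached on input $x$ is labelled by $\mathcal{A}_H(x)$. Its query complexity is the maximum over $x\in\mathbb{R}^n$ of the number of queries made on input $x$. There is an absolute constant $C>0$ such that the following holds. Let $n$ be a nonnegative integer, $w$ a real number, and $H\subset\mathbb{Z}^n$ with $\|h\|_\infty=\max_i|h_i|\le w$ for all $h\in H$. If $nw\ge 2$ and $|H|\ge 2$, then there is a comparison decision tree for $H$ that computes $\mathcal{A}_H$ and has query complexity at most $$C\, n\,\log(nw)\,\log|H|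 .$$ -/

import Mathlib

/-- The sign vector `A_H(x) = (sign ⟨h, x⟩ : h ∈ H)` of the point-location problem for `H`. -/
noncomputable def signVector {n : ℕ} (H : Finset (Fin n → ℝ)) (x : Fin n → ℝ) :
    H → SignType :=
  fun h => SignType.sign ((h : Fin n → ℝ) ⬝ᵥ x)

/-- Ternary linear decision trees on `ℝⁿ` with outputs in `α`. An inner node carries the vector `v`
of the linear query `sign ⟨v, x⟩ = ?` and one subtree for each of the three possible answers. -/
inductive LinearDecisionTree (n : ℕ) (α : Type) : Type
  | leaf (output : α) : LinearDecisionTree n α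
  | node (v : Fin n → ℝ) (next : SignType → LinearDecisionTree n α) : LinearDecisionTree n α

namespace LinearDecisionTree

/-- The output of the tree on input `x`. -/
noncomputable def eval {n : ℕ} {α : Type} : LinearDecisionTree n α → (Fin n → ℝ) → α
  | leaf output, _ => output
  | node v next, x => (next (SignType.sign (v ⬝ᵥ x))).eval x

/-- The number of queries that the tree performs on input `x`. -/
noncomputable def numQueries {n : ℕ} {α : Type} : LinearDecisionTree n α → (Fin n → ℝ) → ℕ
  | leaf _, _ => 0
  | node v next, x => (next (SignType.sign (v ⬝ᵥ x))).numQueries x + 1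

/-- Every query of the tree is a label query (its vector lies in `H`) or a comparison query
(its vector is a difference of two elements of `H`). -/
def IsComparison {n : ℕ} {α : Type} (H : Finset (Fin n → ℝ)) : LinearDecisionTree n α → Prop
  | leaf _ => True
  | node v next =>
      (v ∈ H ∨ ∃ h' ∈ H, ∃ h'' ∈ H, v = h' - h'') ∧ ∀ s, (next s).IsComparison H

/-- The tree computes `f` correctly on every input. -/
def Computes {n : ℕ} {α : Type} (T : LinearDecisionTree n α) (f : (Fin n → ℝ) → α) : Prop :=
  ∀ x, T.eval x = f x

/-- The query complexity of `T` (the maximum over `x` of the number of queries) is at most `q`. -/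
def QueryComplexityLE {n : ℕ} {α : Type} (T : LinearDecisionTree n α) (q : ℝ) : Prop :=
  ∀ x, (T.numQueries x : ℝ) ≤ q

end LinearDecisionTree

/-!
Comparisons make sign vectors compressible. Order `m` forms by their values at `x`. If
`(4 * w * m + 1) ^ n < 2 ^ m`, two subsets of their consecutive differences have the same sum, by
the pigeonhole principle. Cancelling common terms, and using that a sum of nonnegative differences
is nonnegative, one form is then a sum of terms whose signs at `x` follow from comparisons of the
other forms, so its own sign follows too: the inference dimension `d` is `O(n log (n w))`.

Given a finite set of inputs, take a random sample of `16 * d` of the unresolved forms. By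
exchangeability and an exponential moment bound, knowing the order of the sample at `x` determines
at least half of the unresolved signs for all but a `2 ^ (-3 * d)` fraction of the inputs `x`. The
sample is sorted by binary search over the inputs rather than over the sample: a query either
halves the number of surviving inputs or completes an insertion, so sorting costs `O(d)` queries
up to a potential `O(log |X|)` that is paid only once overall.

Finally every input orders `H ∪ {0}` like one of `|H| ^ O(n)` representatives, by the Sauer–Shelah
lemma applied to sign patterns of linear forms, and `O(log |H|)` halvings suffice.
-/

section Sampling

open Finset

/-- The inference dimension of `R` is at most `d`: among any more than `d` elements of `R` there is
one that is inferred from the others. An inference procedure is encoded as the map `c` that sends a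
set to the set of all elements inferred from it. -/
def InferenceDimLE {α : Type*} (c : Set α → Set α) (R : Finset α) (d : ℕ) : Prop :=
  ∀ s ⊆ R, d < #s → ∃ a ∈ s, a ∈ c (↑s \ {a})

variable {α β ι κ : Type*} {c : Set α → Set α} {R S : Finset α} {d : ℕ}

theorem InferenceDimLE.subset (hR : InferenceDimLE c R d) (hSR : S ⊆ R) : InferenceDimLE c S d :=
  fun s hs => hR s (hs.trans hSR)

open Classical in
theorem InferenceDimLE.card_filter_notMem_diff_le (hR : InferenceDimLE c R d) (hc : Monotone c)
    (hsub : ∀ S, S ⊆ c S) {W : κ → α} (hW : ∀ i, W i ∈ R) (t : Finset κ) :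
    #{p ∈ t | W p ∉ c (W '' (↑t \ {p}))} ≤ d := by
  set U := {p ∈ t | W p ∉ c (W '' (↑t \ {p}))}
  by_contra! hU
  have hinj : Set.InjOn W U := by
    intro p hp q hq hpq
    by_contra hne
    exact (mem_filter.1 hp).2 (hsub _ ⟨q, ⟨(mem_filter.1 hq).1, Ne.symm hne⟩, hpq.symm⟩)
  obtain ⟨a, ha, hinf⟩ := hR (U.image W) (image_subset_iff.2 fun i _ => hW i)
    (by rwa [card_image_of_injOn hinj])
  obtain ⟨p, hp, rfl⟩ := mem_image.1 ha
  refine (mem_filter.1 hp).2 (hc ?_ hinf)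
  rintro _ ⟨hb, hne⟩
  obtain ⟨q, hq, rfl⟩ := mem_image.1 (mem_coe.1 hb)
  exact ⟨q, ⟨(mem_filter.1 hq).1, fun hqp => hne (congrArg W hqp)⟩, rfl⟩

open Classical in
-- Exchanging position `i` with a position of `s` preserves `B`, so the average over `B` may also be
-- taken over the `#s + 1` choices of the position that is left out of `insert i s`.
theorem InferenceDimLE.card_filter_notMem_image_le (hR : InferenceDimLE c R d) (hc : Monotone c)
    (hsub : ∀ S, S ⊆ c S) {B : Finset (κ → α)} (hBR : ∀ W ∈ B, ∀ i, W i ∈ R)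
    (hB : ∀ W ∈ B, ∀ σ : Equiv.Perm κ, W ∘ σ ∈ B) {i : κ} {s : Finset κ} (hi : i ∉ s) :
    (#s + 1) * #{W ∈ B | W i ∉ c (W '' s)} ≤ d * #B := by
  set t := insert i s
  have hswap (p : κ) (hp : p ∈ t) :
      #{W ∈ B | W i ∉ c (W '' s)} = #{W ∈ B | W p ∉ c (W '' (↑t \ {p}))} := by
    have himage : Equiv.swap i p '' s = ↑t \ {p} := by
      have hs : (s : Set κ) = ↑t \ {i} := by simp [t, hi]
      have htt : Equiv.swap i p '' t = t := by
        rw [Equiv.image_eq_preimage_symm, Equiv.symm_swap]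
        ext q
        simp only [Set.mem_preimage, mem_coe, Equiv.swap_apply_def]
        split_ifs <;> simp_all [t]
      rw [hs, Set.image_sdiff (Equiv.injective _), htt, Set.image_singleton, Equiv.swap_apply_left]
    refine card_equiv ((Equiv.swap i p).arrowCongr (Equiv.refl α)) fun W => ?_
    have hW : W ∈ B ↔ W ∘ Equiv.swap i p ∈ B :=
      ⟨fun h => hB W h _, fun h => by
        simpa [Function.comp_def] using hB _ h (Equiv.swap i p)⟩
    rw [mem_filter, mem_filter, hW]
    have happly : (Equiv.swap i p).arrowCongr (Equiv.refl α) W = W ∘ Equiv.swap i p := by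
      ext; simp
    rw [happly, ← himage, ← Set.image_comp]
    simp [Function.comp_def]
  calc (#s + 1) * #{W ∈ B | W i ∉ c (W '' s)}
      = ∑ p ∈ t, #{W ∈ B | W p ∉ c (W '' (↑t \ {p}))} := by
        rw [← sum_congr rfl hswap, sum_const, card_insert_of_notMem hi, smul_eq_mul]
    _ = ∑ W ∈ B, #{p ∈ t | W p ∉ c (W '' (↑t \ {p}))} :=
        sum_card_bipartiteAbove_eq_sum_card_bipartiteBelow _
    _ ≤ ∑ _W ∈ B, d :=
        sum_le_sum fun W hW => hR.card_filter_notMem_diff_le hc hsub (hBR W hW) t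
    _ = d * #B := by rw [sum_const, smul_eq_mul, mul_comm]

open Classical in
theorem InferenceDimLE.sub_mul_card_le_sum_card_filter_mem [Fintype ι] (hR : InferenceDimLE c R d)
    (hc : Monotone c) (hsub : ∀ S, S ⊆ c S) {B : Finset (ι ⊕ ι → α)}
    (hBR : ∀ W ∈ B, ∀ i, W i ∈ R) (hB : ∀ W ∈ B, ∀ σ : Equiv.Perm (ι ⊕ ι), W ∘ σ ∈ B) :
    (Fintype.card ι - d) * #B ≤
      ∑ W ∈ B, #{i | W (.inl i) ∈ c (Set.range (W ∘ Sum.inr))} := by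
  have hnotMem : ∑ W ∈ B, #{i | W (.inl i) ∉ c (Set.range (W ∘ Sum.inr))} ≤ d * #B := by
    refine Nat.le_of_mul_le_mul_left (?_ : (Fintype.card ι + 1) * _ ≤ _) (Nat.succ_pos _)
    calc (Fintype.card ι + 1) * ∑ W ∈ B, #{i | W (.inl i) ∉ c (Set.range (W ∘ Sum.inr))}
        = ∑ i, (Fintype.card ι + 1) * #{W ∈ B | W (.inl i) ∉ c (Set.range (W ∘ Sum.inr))} := by
          rw [← mul_sum]
          congr 1
          exact sum_card_bipartiteAbove_eq_sum_card_bipartiteBelow _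
      _ ≤ ∑ _i : ι, d * #B := sum_le_sum fun i _ => by
          simpa [Set.range_comp] using hR.card_filter_notMem_image_le hc hsub hBR hB
            (i := .inl i) (s := univ.map .inr) (by simp)
      _ = Fintype.card ι * (d * #B) := by rw [sum_const, card_univ, smul_eq_mul]
      _ ≤ (Fintype.card ι + 1) * (d * #B) := Nat.mul_le_mul_right _ (Nat.le_succ _)
  have htotal : ∑ W ∈ B, #{i | W (.inl i) ∈ c (Set.range (W ∘ Sum.inr))} +
      ∑ W ∈ B, #{i | W (.inl i) ∉ c (Set.range (W ∘ Sum.inr))} = Fintype.card ι * #B := by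
    simp_rw [← sum_add_distrib, card_filter_add_card_filter_not, sum_const, card_univ, smul_eq_mul,
      mul_comm]
  rw [Nat.sub_mul]
  omega

theorem card_mul_pow_le_sum_pow {B : Finset β} {f : β → ℕ} {b e : ℕ} (hb : 0 < b)
    (hf : e * #B ≤ ∑ W ∈ B, f W) : b ^ e * #B ≤ ∑ W ∈ B, b ^ f W := by
  have hb' : (0 : ℝ) < b := by exact_mod_cast hb
  have hlog : 0 ≤ Real.log b := Real.log_natCast_nonneg b
  have htangent (k : ℕ) : (b : ℝ) ^ e * (1 + (k - e) * Real.log b) ≤ b ^ k := by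
    have h := Real.add_one_le_exp (((k : ℝ) - e) * Real.log b)
    rw [mul_comm _ (Real.log b), ← Real.rpow_def_of_pos hb', Real.rpow_sub hb', Real.rpow_natCast,
      Real.rpow_natCast, le_div_iff₀ (by positivity)] at h
    linarith
  have hf' : (e : ℝ) * #B ≤ ∑ W ∈ B, (f W : ℝ) := by exact_mod_cast hf
  suffices (b : ℝ) ^ e * #B ≤ ∑ W ∈ B, (b : ℝ) ^ f W by exact_mod_cast this
  calc (b : ℝ) ^ e * #B
      ≤ b ^ e * (#B + (∑ W ∈ B, (f W : ℝ) - e * #B) * Real.log b) :=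
        mul_le_mul_of_nonneg_left
          (le_add_of_nonneg_right (mul_nonneg (sub_nonneg.2 hf') hlog)) (by positivity)
    _ = ∑ W ∈ B, (b : ℝ) ^ e * (1 + (f W - e) * Real.log b) := by
        rw [← mul_sum, sum_add_distrib, ← sum_mul, sum_sub_distrib]
        simp [mul_comm]
    _ ≤ ∑ W ∈ B, (b : ℝ) ^ f W := sum_le_sum fun W _ => htangent (f W)

open Classical in
theorem sum_three_pow_ite_mem_le {s : Set α} (hs : 2 * #{a ∈ R | a ∈ s} ≤ #R) :
    ∑ a ∈ R, 3 ^ (if a ∈ s then 1 else 0) ≤ 2 * #R := by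
  have hsplit := card_filter_add_card_filter_not (s := R) (· ∈ s)
  simp only [pow_ite, pow_one, pow_zero, sum_ite, sum_const, smul_eq_mul]
  omega

open Classical in
-- Given the second half of `W`, the entries of the first half are independent, and each of them is
-- inferred with probability at most `1 / 2`.
theorem sum_three_pow_card_filter_mem_le [Fintype ι] {B : Finset (ι ⊕ ι → α)}
    (hBR : ∀ W ∈ B, ∀ i, W i ∈ R)
    (hB : ∀ W ∈ B, 2 * #{a ∈ R | a ∈ c (Set.range (W ∘ Sum.inr))} ≤ #R) :
    ∑ W ∈ B, 3 ^ #{i | W (.inl i) ∈ c (Set.range (W ∘ Sum.inr))} ≤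
      2 ^ Fintype.card ι * #R ^ (2 * Fintype.card ι) := by
  let P : Finset (ι → α) := Fintype.piFinset fun _ => R
  let Q : Finset (ι → α) := {v ∈ P | 2 * #{a ∈ R | a ∈ c (Set.range v)} ≤ #R}
  calc ∑ W ∈ B, 3 ^ #{i | W (.inl i) ∈ c (Set.range (W ∘ Sum.inr))}
      = ∑ uv ∈ B.map (Equiv.sumArrowEquivProdArrow ι ι α).toEmbedding,
          3 ^ #{i | uv.1 i ∈ c (Set.range uv.2)} := by
        rw [sum_map]; rfl
    _ ≤ ∑ uv ∈ P ×ˢ Q, 3 ^ #{i | uv.1 i ∈ c (Set.range uv.2)} := by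
        refine sum_le_sum_of_subset fun uv huv => ?_
        obtain ⟨W, hW, rfl⟩ := mem_map.1 huv
        exact mem_product.2 ⟨Fintype.mem_piFinset.2 fun i => hBR W hW _,
          mem_filter.2 ⟨Fintype.mem_piFinset.2 fun i => hBR W hW _, hB W hW⟩⟩
    _ = ∑ v ∈ Q, (∑ a ∈ R, 3 ^ (if a ∈ c (Set.range v) then 1 else 0)) ^ Fintype.card ι := by
        rw [sum_product_right]
        refine sum_congr rfl fun v _ => ?_
        rw [← card_univ, ← prod_const, prod_univ_sum]
        simp_rw [card_filter, prod_pow_eq_pow_sum]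
        rfl
    _ ≤ ∑ _v ∈ Q, (2 * #R) ^ Fintype.card ι := sum_le_sum fun v hv =>
        Nat.pow_le_pow_left (sum_three_pow_ite_mem_le (mem_filter.1 hv).2) _
    _ ≤ #P * (2 * #R) ^ Fintype.card ι := by
        rw [sum_const, smul_eq_mul]
        exact Nat.mul_le_mul_right _ (card_filter_le _ _)
    _ = 2 ^ Fintype.card ι * #R ^ (2 * Fintype.card ι) := by
        rw [Fintype.card_piFinset, prod_const, card_univ]
        ring

open Classical in
theorem InferenceDimLE.two_pow_mul_card_filter_le (hR : InferenceDimLE c R d) (hc : Monotone c)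
    (hsub : ∀ S, S ⊆ c S) :
    2 ^ (3 * d) * #{W ∈ Fintype.piFinset fun _ : Fin (8 * d) ⊕ Fin (8 * d) => R |
      2 * #{a ∈ R | a ∈ c (Set.range W)} ≤ #R} ≤ #R ^ (16 * d) := by
  set B := {W ∈ Fintype.piFinset fun _ : Fin (8 * d) ⊕ Fin (8 * d) => R |
    2 * #{a ∈ R | a ∈ c (Set.range W)} ≤ #R}
  have hBR : ∀ W ∈ B, ∀ i, W i ∈ R := fun W hW => Fintype.mem_piFinset.1 (mem_filter.1 hW).1
  have hBperm : ∀ W ∈ B, ∀ σ : Equiv.Perm (Fin (8 * d) ⊕ Fin (8 * d)), W ∘ σ ∈ B := by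
    intro W hW σ
    refine mem_filter.2 ⟨Fintype.mem_piFinset.2 fun i => hBR W hW _, ?_⟩
    rw [σ.surjective.range_comp]
    exact (mem_filter.1 hW).2
  have hBhalf : ∀ W ∈ B, 2 * #{a ∈ R | a ∈ c (Set.range (W ∘ Sum.inr))} ≤ #R := by
    refine fun W hW => le_trans ?_ (mem_filter.1 hW).2
    gcongr
    exact hc (Set.range_comp_subset_range _ _)
  have hupper := sum_three_pow_card_filter_mem_le hBR hBhalf
  have hlower := card_mul_pow_le_sum_pow three_pos
    (hR.sub_mul_card_le_sum_card_filter_mem hc hsub hBR hBperm)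
  rw [Fintype.card_fin] at hupper hlower
  refine Nat.le_of_mul_le_mul_left (?_ : 2 ^ (8 * d) * _ ≤ _) (by positivity)
  calc 2 ^ (8 * d) * (2 ^ (3 * d) * #B)
      = (2 ^ 11) ^ d * #B := by rw [← mul_assoc, ← pow_add, ← pow_mul]; ring_nf
    _ ≤ (3 ^ 7) ^ d * #B := Nat.mul_le_mul_right _ (Nat.pow_le_pow_left (by norm_num) d)
    _ = 3 ^ (8 * d - d) * #B := by rw [← pow_mul]; congr 2; omega
    _ ≤ 2 ^ (8 * d) * #R ^ (2 * (8 * d)) := hlower.trans hupper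
    _ = 2 ^ (8 * d) * #R ^ (16 * d) := by ring

theorem exists_mul_card_filter_le {X : Finset β} {P : Finset α} {r : α → β → Prop}
    [∀ i x, Decidable (r i x)] {k : ℕ} (hP : P.Nonempty) (h : ∀ x ∈ X, k * #{i ∈ P | r i x} ≤ #P) :
    ∃ i ∈ P, k * #{x ∈ X | r i x} ≤ #X := by
  refine exists_le_of_sum_le hP ?_
  calc ∑ i ∈ P, k * #{x ∈ X | r i x}
      = ∑ x ∈ X, k * #{i ∈ P | r i x} := by
        rw [← mul_sum, ← mul_sum]
        congr 1
        exact sum_card_bipartiteAbove_eq_sum_card_bipartiteBelow r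
    _ ≤ ∑ _x ∈ X, #P := sum_le_sum h
    _ = ∑ _i ∈ P, #X := by rw [sum_const, sum_const, smul_eq_mul, smul_eq_mul, mul_comm]

open Classical in
theorem exists_sample {c : β → Set α → Set α} {X : Finset β} (hRne : R.Nonempty)
    (hc : ∀ x, Monotone (c x)) (hsub : ∀ x S, S ⊆ c x S) (hR : ∀ x, InferenceDimLE (c x) R d) :
    ∃ T ⊆ R, #T ≤ 16 * d ∧ 2 ^ (3 * d) * #{x ∈ X | 2 * #{a ∈ R | a ∈ c x T} ≤ #R} ≤ #X := by
  obtain ⟨W, hW, hcard⟩ := exists_mul_card_filter_le (X := X) (k := 2 ^ (3 * d))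
    (P := Fintype.piFinset fun _ : Fin (8 * d) ⊕ Fin (8 * d) => R)
    (r := fun W x => 2 * #{a ∈ R | a ∈ c x (Set.range W)} ≤ #R)
    (Fintype.piFinset_nonempty.2 fun _ => hRne) fun x _ => by
      refine ((hR x).two_pow_mul_card_filter_le (hc x) (hsub x)).trans_eq ?_
      rw [Fintype.card_piFinset, prod_const, card_univ, Fintype.card_sum, Fintype.card_fin]
      ring_nf
  refine ⟨univ.image W, image_subset_iff.2 fun i _ => Fintype.mem_piFinset.1 hW i, ?_, ?_⟩
  · calc #(univ.image W) ≤ Fintype.card (Fin (8 * d) ⊕ Fin (8 * d)) := card_image_le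
      _ = 16 * d := by rw [Fintype.card_sum, Fintype.card_fin]; ring
  · rwa [coe_image, coe_univ, Set.image_univ]

end Sampling

section Comparisons

variable {n : ℕ} {S T : Set (Fin n → ℝ)} {x y : Fin n → ℝ}

/-- The linear forms in `T` are ordered by their values at `x` in the same way as by their values
at `y`. -/
def SameOrder (T : Set (Fin n → ℝ)) (x y : Fin n → ℝ) : Prop :=
  ∀ s ∈ T, ∀ t ∈ T, s ⬝ᵥ x < t ⬝ᵥ x ↔ s ⬝ᵥ y < t ⬝ᵥ y

namespace SameOrder

theorem mono (h : SameOrder T x y) (hST : S ⊆ T) : SameOrder S x y :=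
  fun s hs t ht => h s (hST hs) t (hST ht)

theorem le_iff (h : SameOrder T x y) {s t : Fin n → ℝ} (hs : s ∈ T) (ht : t ∈ T) :
    s ⬝ᵥ x ≤ t ⬝ᵥ x ↔ s ⬝ᵥ y ≤ t ⬝ᵥ y := by
  rw [← not_lt, ← not_lt, h t ht s hs]

theorem neg (h : SameOrder T x y) : SameOrder T (-x) (-y) := fun s hs t ht => by
  simpa using h t ht s hs

theorem sign_sub_dotProduct_eq (h : SameOrder T x y) {s t : Fin n → ℝ} (hs : s ∈ T) (ht : t ∈ T) :
    SignType.sign ((s - t) ⬝ᵥ x) = SignType.sign ((s - t) ⬝ᵥ y) := by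
  simp only [sign_apply, sub_dotProduct, sub_pos, sub_neg, h s hs t ht, h t ht s hs]

theorem sign_dotProduct_eq (h : SameOrder T x y) {s : Fin n → ℝ} (hs : s ∈ T) (h0 : 0 ∈ T) :
    SignType.sign (s ⬝ᵥ x) = SignType.sign (s ⬝ᵥ y) := by
  simpa using h.sign_sub_dotProduct_eq hs h0

end SameOrder

/-- The linear forms whose sign at `x` is determined by the signs at `x` of the forms in `S` and of
their differences; adding `0` to `S` turns the signs of the forms themselves into comparisons. -/
def inferred (x : Fin n → ℝ) (S : Set (Fin n → ℝ)) : Set (Fin n → ℝ) :=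
  {h | ∀ y, SameOrder (insert 0 S) x y → SignType.sign (h ⬝ᵥ x) = SignType.sign (h ⬝ᵥ y)}

theorem monotone_inferred (x : Fin n → ℝ) : Monotone (inferred x) :=
  fun _ _ hST _ hh y hy => hh y (hy.mono (Set.insert_subset_insert hST))

theorem sub_mem_inferred {a b : Fin n → ℝ} (ha : a ∈ insert 0 S) (hb : b ∈ insert 0 S) :
    a - b ∈ inferred x S :=
  fun _ hy => hy.sign_sub_dotProduct_eq ha hb

theorem subset_inferred (x : Fin n → ℝ) (S : Set (Fin n → ℝ)) : S ⊆ inferred x S :=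
  fun _ hh _ hy => hy.sign_dotProduct_eq (.inr hh) (.inl rfl)

theorem inferred_neg (x : Fin n → ℝ) (S : Set (Fin n → ℝ)) : inferred (-x) S = inferred x S := by
  ext h
  refine ⟨fun hh y hy => ?_, fun hh y hy => ?_⟩
  · simpa [Left.sign_neg] using hh (-y) hy.neg
  · simpa [Left.sign_neg, neg_eq_iff_eq_neg] using hh (-y) (by simpa using hy.neg)

theorem sign_add_eq_sign_add_of_nonneg {a b a' b' : ℝ} (ha : 0 ≤ a) (hb : 0 ≤ b)
    (haa' : SignType.sign a = SignType.sign a') (hbb' : SignType.sign b = SignType.sign b') :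
    SignType.sign (a + b) = SignType.sign (a' + b') := by
  rcases ha.eq_or_lt with rfl | ha
  · rw [sign_zero, eq_comm, sign_eq_zero_iff] at haa'
    simpa [haa'] using hbb'
  · have ha' : 0 < a' := by rwa [sign_pos ha, eq_comm, sign_eq_one_iff] at haa'
    have hb' : 0 ≤ b' := by rwa [← sign_nonneg_iff, ← hbb', sign_nonneg_iff]
    rw [sign_pos (by positivity), sign_pos (by positivity)]

/-- The inferred forms that are nonnegative at `x`. A sum of forms with known nonnegative signs has
a known sign, so they are closed under addition. -/
def nonnegInferred (x : Fin n → ℝ) (S : Set (Fin n → ℝ)) : AddSubmonoid (Fin n → ℝ) where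
  carrier := {h ∈ inferred x S | 0 ≤ h ⬝ᵥ x}
  zero_mem' := ⟨by simpa using sub_mem_inferred (.inl rfl) (.inl rfl), by simp⟩
  add_mem' ha hb := by
    refine ⟨fun y hy => ?_, by simpa only [add_dotProduct] using add_nonneg ha.2 hb.2⟩
    simpa only [add_dotProduct] using
      sign_add_eq_sign_add_of_nonneg ha.2 hb.2 (ha.1 y hy) (hb.1 y hy)

theorem sum_nsmul_sub_mem_inferred {v : ℕ → Fin n → ℝ} {p : ℕ} (c : ℕ → ℕ)
    (hv : ∀ j ≤ p, v j ∈ insert 0 S) (hmono : ∀ j < p, v j ⬝ᵥ x ≤ v (j + 1) ⬝ᵥ x) :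
    ∑ j ∈ Finset.range p, c j • (v (j + 1) - v j) ∈ inferred x S := by
  suffices ∑ j ∈ Finset.range p, c j • (v (j + 1) - v j) ∈ nonnegInferred x S from this.1
  refine sum_mem fun j hj => nsmul_mem (show _ ∧ _ from ⟨?_, ?_⟩) _
  · exact sub_mem_inferred (hv _ (Finset.mem_range.1 hj)) (hv _ (Finset.mem_range.1 hj).le)
  · simpa [sub_dotProduct] using hmono j (Finset.mem_range.1 hj)

theorem exists_sum_eq_sum_of_pow_lt_two_pow {ι κ : Type*} [Fintype κ] {s : Finset ι}
    {v : ι → κ → ℝ} {b : ℝ} (hb : 0 ≤ b) (hv : ∀ j ∈ s, ∀ i, ∃ k : ℤ, v j i = k)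
    (hvb : ∀ j ∈ s, ‖v j‖ ≤ b) (hs : (2 * b * s.card + 1) ^ Fintype.card κ < 2 ^ s.card) :
    ∃ A ⊆ s, ∃ B ⊆ s, A ≠ B ∧ ∑ j ∈ A, v j = ∑ j ∈ B, v j := by
  classical
  choose! z hz using hv
  let K : ℕ := ⌊b * s.card⌋₊
  have hmaps : ∀ A ∈ s.powerset, (fun i => ∑ j ∈ A, z j i) ∈
      Fintype.piFinset fun _ : κ => Finset.Icc (-(K : ℤ)) K := by
    intro A hA
    rw [Finset.mem_powerset] at hA
    refine Fintype.mem_piFinset.2 fun i => ?_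
    rw [Finset.mem_Icc, ← abs_le, Int.abs_eq_natAbs, Nat.cast_le, Nat.le_floor_iff (by positivity),
      Nat.cast_natAbs, Int.cast_abs]
    push_cast
    calc |∑ j ∈ A, (z j i : ℝ)| ≤ ∑ j ∈ A, |(z j i : ℝ)| := Finset.abs_sum_le_sum_abs _ _
      _ ≤ ∑ _j ∈ A, b := Finset.sum_le_sum fun j hj => by
          rw [← hz j (hA hj) i]
          exact (norm_le_pi_norm (v j) i).trans (hvb j (hA hj))
      _ = b * A.card := by rw [Finset.sum_const, nsmul_eq_mul, mul_comm]
      _ ≤ b * s.card := by gcongr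
  have hcard : (Fintype.piFinset fun _ : κ => Finset.Icc (-(K : ℤ)) K).card < s.powerset.card := by
    have hK : (Finset.Icc (-(K : ℤ)) K).card = 2 * K + 1 := by rw [Int.card_Icc]; omega
    rw [Fintype.card_piFinset, Finset.prod_const, Finset.card_univ, hK, Finset.card_powerset]
    have hfloor : (2 * K + 1 : ℝ) ≤ 2 * b * s.card + 1 := by
      linarith [Nat.floor_le (show 0 ≤ b * s.card by positivity)]
    exact_mod_cast (pow_le_pow_left₀ (by positivity) hfloor _).trans_lt hs
  obtain ⟨A, hA, B, hB, hAB, hsum⟩ := Finset.exists_ne_map_eq_of_card_lt_of_maps_to hcard hmaps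
  rw [Finset.mem_powerset] at hA hB
  refine ⟨A, hA, B, hB, hAB, funext fun i => ?_⟩
  rw [Finset.sum_apply, Finset.sum_apply, Finset.sum_congr rfl fun j hj => hz j (hA hj) i,
    Finset.sum_congr rfl fun j hj => hz j (hB hj) i]
  exact_mod_cast congrFun hsum i

theorem exists_eq_add_sum_nsmul_sub_of_mem_of_notMem {E : Type*} [AddCommGroup E] {g : ℕ → E}
    {A B : Finset ℕ} {p : ℕ} (hA : p ∈ A) (hB : p ∉ B) (hgt : ∀ q, p < q → (q ∈ A ↔ q ∈ B))
    (hAB : ∑ j ∈ A, (g (j + 1) - g j) = ∑ j ∈ B, (g (j + 1) - g j)) :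
    ∃ c : ℕ → ℕ, g (p + 1) = g 0 + ∑ j ∈ Finset.range p, c j • (g (j + 1) - g j) := by
  have hsplit (C : Finset ℕ) : ∑ j ∈ C, (g (j + 1) - g j) =
      (∑ j ∈ Finset.range p, if j ∈ C then g (j + 1) - g j else 0) +
        ∑ j ∈ C with p ≤ j, (g (j + 1) - g j) := by
    rw [← Finset.sum_filter_not_add_sum_filter C (p ≤ ·), ← Finset.sum_filter]
    congr 2
    ext j
    simp [and_comm]
  have htail : ({j ∈ A | p ≤ j} : Finset ℕ) = insert p {j ∈ B | p ≤ j} := by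
    ext j
    simp only [Finset.mem_filter, Finset.mem_insert]
    rcases lt_trichotomy p j with h | rfl | h
    · simp [hgt j h, h.ne', h.le]
    · simp [hA]
    · simp [h.ne, h.not_ge]
  -- Adding the telescoping sum of all differences keeps every coefficient nonnegative.
  let c (j : ℕ) : ℕ := if j ∈ A then if j ∈ B then 1 else 0 else if j ∈ B then 2 else 1
  have hc (j : ℕ) : c j • (g (j + 1) - g j) + (if j ∈ A then g (j + 1) - g j else 0) =
      (g (j + 1) - g j) + if j ∈ B then g (j + 1) - g j else 0 := by
    by_cases hjA : j ∈ A <;> by_cases hjB : j ∈ B <;> simp [c, hjA, hjB, two_nsmul]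
  have hsum := Finset.sum_congr (rfl : Finset.range p = _) fun j _ => hc j
  rw [Finset.sum_add_distrib, Finset.sum_add_distrib, Finset.sum_range_sub] at hsum
  rw [hsplit A, hsplit B, htail, Finset.sum_insert (by simp [hB])] at hAB
  exact ⟨c, by linear_combination (norm := module) hAB - hsum⟩

theorem exists_eq_add_sum_nsmul_sub {E : Type*} [AddCommGroup E] {g : ℕ → E} {A B : Finset ℕ}
    (hne : A ≠ B) (hAB : ∑ j ∈ A, (g (j + 1) - g j) = ∑ j ∈ B, (g (j + 1) - g j)) :
    ∃ p ∈ A ∪ B, ∃ c : ℕ → ℕ,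
      g (p + 1) = g 0 + ∑ j ∈ Finset.range p, c j • (g (j + 1) - g j) := by
  have hsymm : (symmDiff A B).Nonempty := Finset.symmDiff_nonempty.2 hne
  obtain ⟨p, hp, hmax⟩ := (symmDiff A B).exists_max_image id hsymm
  have hgt (q : ℕ) (hq : p < q) : q ∈ A ↔ q ∈ B := by
    have := mt (hmax q) hq.not_ge
    rw [Finset.mem_symmDiff] at this
    tauto
  refine ⟨p, (Finset.symmDiff_subset_union hp), ?_⟩
  rcases Finset.mem_symmDiff.1 hp with ⟨hA, hB⟩ | ⟨hB, hA⟩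
  · exact exists_eq_add_sum_nsmul_sub_of_mem_of_notMem hA hB hgt hAB
  · exact exists_eq_add_sum_nsmul_sub_of_mem_of_notMem hB hA (fun q hq => (hgt q hq).symm) hAB.symm

theorem exists_eq_add_sum_nsmul_sub_of_norm_le {κ : Type*} [Fintype κ] {v : ℕ → κ → ℝ} {w : ℝ}
    {m : ℕ} (hw : 0 ≤ w) (hm : (4 * w * m + 1) ^ Fintype.card κ < 2 ^ m)
    (hint : ∀ j ≤ m, ∀ i, ∃ k : ℤ, v j i = k) (hnorm : ∀ j ≤ m, ‖v j‖ ≤ w) :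
    ∃ p < m, ∃ c : ℕ → ℕ,
      v (p + 1) = v 0 + ∑ j ∈ Finset.range p, c j • (v (j + 1) - v j) := by
  have hsubint (j : ℕ) (hj : j ∈ Finset.range m) (i : κ) : ∃ k : ℤ, (v (j + 1) - v j) i = k := by
    obtain ⟨k, hk⟩ := hint (j + 1) (Finset.mem_range.1 hj) i
    obtain ⟨l, hl⟩ := hint j (Finset.mem_range.1 hj).le i
    exact ⟨k - l, by simp [hk, hl]⟩
  have hsubnorm (j : ℕ) (hj : j ∈ Finset.range m) : ‖v (j + 1) - v j‖ ≤ 2 * w := by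
    linarith [norm_sub_le (v (j + 1)) (v j), hnorm (j + 1) (Finset.mem_range.1 hj),
      hnorm j (Finset.mem_range.1 hj).le]
  obtain ⟨A, hA, B, hB, hne, hsum⟩ := exists_sum_eq_sum_of_pow_lt_two_pow (by positivity) hsubint
    hsubnorm (by rw [Finset.card_range]; convert hm using 3; ring)
  obtain ⟨p, hp, hc⟩ := exists_eq_add_sum_nsmul_sub hne hsum
  exact ⟨p, Finset.mem_range.1 (Finset.union_subset hA hB hp), hc⟩

theorem exists_monotoneOn_enumeration {α β : Type*} [LinearOrder β] {s : Finset α} (hs : s.Nonempty)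
    (f : α → β) : ∃ g : ℕ → α, Set.MapsTo g (Set.Iio s.card) s ∧
      Set.InjOn g (Set.Iio s.card) ∧ MonotoneOn (f ∘ g) (Set.Iio s.card) := by
  have : NeZero s.card := ⟨hs.card_pos.ne'⟩
  let F : Fin s.card → β := fun i => f (s.equivFin.symm i)
  refine ⟨fun j => s.equivFin.symm (Tuple.sort F (Fin.ofNat s.card j)),
    fun j _ => Subtype.coe_prop _, fun i hi j hj hij => ?_, fun i hi j hj hij => ?_⟩
  · have h := congrArg Fin.val
      ((Tuple.sort F).injective (s.equivFin.symm.injective (Subtype.ext hij)))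
    simpa [Nat.mod_eq_of_lt hi, Nat.mod_eq_of_lt hj] using h
  · refine Tuple.monotone_sort F (Fin.le_def.2 ?_)
    simpa [Nat.mod_eq_of_lt hi, Nat.mod_eq_of_lt hj] using hij

theorem exists_mem_inferred_of_nonneg {w : ℝ} {m : ℕ} (hw : 0 ≤ w)
    (hm : (4 * w * m + 1) ^ n < 2 ^ m) {s : Finset (Fin n → ℝ)} (hms : m ≤ s.card)
    (hint : ∀ h ∈ s, ∀ i, ∃ k : ℤ, h i = k) (hnorm : ∀ h ∈ s, ‖h‖ ≤ w)
    (hx : ∀ h ∈ s, 0 ≤ h ⬝ᵥ x) : ∃ h ∈ s, h ∈ inferred x (↑s \ {h}) := by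
  have hmpos : 0 < m := Nat.pos_of_ne_zero fun h => by simp [h] at hm
  obtain ⟨g, hgs, hginj, hgmono⟩ :=
    exists_monotoneOn_enumeration (Finset.card_pos.1 (hmpos.trans_le hms)) (· ⬝ᵥ x)
  let v : ℕ → Fin n → ℝ := fun j => j.casesOn 0 g
  have hv : ∀ j ≤ m, v j = 0 ∨ v j ∈ s
    | 0, _ => .inl rfl
    | j + 1, hj => .inr (hgs (Nat.lt_of_lt_of_le hj hms))
  obtain ⟨p, hp, c, hc⟩ := exists_eq_add_sum_nsmul_sub_of_norm_le (v := v) hw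
    (by rwa [Fintype.card_fin])
    (fun j hj i => (hv j hj).elim (fun h => ⟨0, by simp [h]⟩) fun h => hint _ h i)
    fun j hj => (hv j hj).elim (fun h => by simpa [h]) (hnorm _)
  have hlt {j : ℕ} (hj : j ≤ p) : j < s.card := hj.trans_lt (hp.trans_le hms)
  refine ⟨g p, hgs (hlt le_rfl), ?_⟩
  have hgp : g p = ∑ j ∈ Finset.range p, c j • (v (j + 1) - v j) := by simpa [v] using hc
  suffices ∑ j ∈ Finset.range p, c j • (v (j + 1) - v j) ∈ inferred x (↑s \ {g p}) by
    rwa [← hgp] at this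
  refine sum_nsmul_sub_mem_inferred c (fun j hj => ?_) fun j hj => ?_
  · cases j with
    | zero => exact .inl rfl
    | succ j => exact .inr ⟨hgs (hlt (by omega)), fun h => by
        have := hginj (hlt (by omega)) (hlt le_rfl) h
        omega⟩
  · cases j with
    | zero => simpa [v] using hx _ (hgs (hlt (Nat.zero_le p)))
    | succ j => exact hgmono (hlt (by omega)) (hlt hj.le) j.le_succ

theorem inferenceDimLE_inferred {w : ℝ} {m : ℕ} (hw : 0 ≤ w)
    (hm : (4 * w * m + 1) ^ n < 2 ^ m) {H : Finset (Fin n → ℝ)}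
    (hint : ∀ h ∈ H, ∀ i, ∃ k : ℤ, h i = k) (hnorm : ∀ h ∈ H, ‖h‖ ≤ w) (x : Fin n → ℝ) :
    InferenceDimLE (inferred x) H (2 * m) := by
  intro s hs hcard
  have hhalf (y : Fin n → ℝ) (hy : inferred y = inferred x)
      (hsy : m ≤ ({h ∈ s | 0 ≤ h ⬝ᵥ y} : Finset _).card) : ∃ h ∈ s, h ∈ inferred x (↑s \ {h}) := by
    have hsub : {h ∈ s | 0 ≤ h ⬝ᵥ y} ⊆ s := Finset.filter_subset _ _
    obtain ⟨h, hh, hinf⟩ := exists_mem_inferred_of_nonneg hw hm hsy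
      (fun h hh => hint h (hs (hsub hh))) (fun h hh => hnorm h (hs (hsub hh)))
      fun h hh => (Finset.mem_filter.1 hh).2
    exact ⟨h, hsub hh, hy ▸ monotone_inferred y (Set.sdiff_subset_sdiff_left hsub) hinf⟩
  have hunion : s.card ≤ ({h ∈ s | 0 ≤ h ⬝ᵥ x} : Finset _).card +
      ({h ∈ s | 0 ≤ h ⬝ᵥ (-x)} : Finset _).card := by
    refine (Finset.card_le_card fun h hh => ?_).trans (Finset.card_union_le _ _)
    simpa [hh] using le_total 0 (h ⬝ᵥ x)
  rcases le_or_gt m ({h ∈ s | 0 ≤ h ⬝ᵥ x} : Finset _).card with h | h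
  · exact hhalf x rfl h
  · exact hhalf (-x) (funext (inferred_neg x)) (by omega)

end Comparisons

section Representatives

open Finset

variable {ι K V : Type*} [Field K] [LinearOrder K] [IsStrictOrderedRing K] [AddCommGroup V]
  [Module K V] {a : ι → V}

-- A functional that is positive exactly where a linear relation has positive coefficients shows
-- that the relation has no positive coefficient.
theorem linearIndepOn_of_forall_subset_exists_pos_iff {s : Finset ι}
    (hs : ∀ t ⊆ s, ∃ f : V →ₗ[K] K, ∀ i ∈ s, i ∈ t ↔ 0 < f (a i)) : LinearIndepOn K a s := by
  classical
  have hnonpos (g : ι → K) (hg : ∑ i ∈ s, g i • a i = 0) (i : ι) (hi : i ∈ s) : g i ≤ 0 := by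
    obtain ⟨f, hf⟩ := hs {j ∈ s | 0 < g j} (filter_subset _ _)
    have hf' (j : ι) (hj : j ∈ s) : 0 < g j ↔ 0 < f (a j) := by simpa [hj] using hf j hj
    have hterm (j : ι) (hj : j ∈ s) : 0 ≤ g j * f (a j) := by
      rcases lt_or_ge 0 (g j) with h | h
      · exact mul_nonneg h.le ((hf' j hj).1 h).le
      · exact mul_nonneg_of_nonpos_of_nonpos h (not_lt.1 fun h' => h.not_gt ((hf' j hj).2 h'))
    have hsum : ∑ j ∈ s, g j * f (a j) = 0 := by simpa using congrArg f hg
    by_contra! hpos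
    exact (mul_pos hpos ((hf' i hi).1 hpos)).ne' ((sum_eq_zero_iff_of_nonneg hterm).1 hsum i hi)
  refine linearIndepOn_finset_iff.2 fun g hg i hi => le_antisymm (hnonpos g hg i hi) ?_
  simpa using hnonpos (-g) (by simpa using hg) i hi

theorem sum_range_choose_le_succ_pow (N D : ℕ) : ∑ k ∈ range (D + 1), N.choose k ≤ (N + 1) ^ D := by
  rw [add_pow]
  refine sum_le_sum fun k hk => ?_
  have hk : k ≤ D := Nat.lt_succ_iff.1 (mem_range.1 hk)
  calc N.choose k ≤ N ^ k := Nat.choose_le_pow N k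
    _ ≤ N ^ k * 1 ^ (D - k) * D.choose k := by
        rw [one_pow, mul_one]
        exact Nat.le_mul_of_pos_right _ (Nat.choose_pos hk)

theorem card_le_succ_pow_finrank_of_forall_exists_pos_iff [Fintype ι] [Module.Finite K V]
    {P : Finset (Finset ι)} (hP : ∀ t ∈ P, ∃ f : V →ₗ[K] K, ∀ i, i ∈ t ↔ 0 < f (a i)) :
    #P ≤ (Fintype.card ι + 1) ^ Module.finrank K V := by
  classical
  have hvc : P.vcDim ≤ Module.finrank K V := by
    refine Finset.sup_le fun s hs => ?_
    have hind : LinearIndepOn K a s :=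
      linearIndepOn_of_forall_subset_exists_pos_iff fun t ht => by
        obtain ⟨u, hu, rfl⟩ := mem_shatterer.1 hs ht
        obtain ⟨f, hf⟩ := hP u hu
        exact ⟨f, fun i hi => by simp [hi, hf i]⟩
    simpa using hind.linearIndependent.fintype_card_le_finrank
  calc #P ≤ #P.shatterer := card_le_card_shatterer P
    _ ≤ ∑ k ∈ Iic P.vcDim, (Fintype.card ι).choose k := card_shatterer_le_sum_vcDim
    _ ≤ ∑ k ∈ range (Module.finrank K V + 1), (Fintype.card ι).choose k :=
        sum_le_sum_of_subset fun k hk =>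
          mem_range.2 (Nat.lt_succ_iff.2 ((mem_Iic.1 hk).trans hvc))
    _ ≤ _ := sum_range_choose_le_succ_pow _ _

theorem exists_sameOrder_representatives {n : ℕ} (T : Finset (Fin n → ℝ)) :
    ∃ X : Finset (Fin n → ℝ), #X ≤ (#T * #T + 1) ^ n ∧ ∀ y, ∃ x ∈ X, SameOrder T y x := by
  classical
  let pattern (y : Fin n → ℝ) : Finset (T × T) := {p | p.1.1 ⬝ᵥ y < p.2.1 ⬝ᵥ y}
  let P : Finset (Finset (T × T)) := {t | t ∈ Set.range pattern}
  refine ⟨P.image (Function.invFun pattern), card_image_le.trans ?_, fun y => ?_⟩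
  · have hP : #P ≤ (Fintype.card (T × T) + 1) ^ Module.finrank ℝ (Fin n → ℝ) := by
      refine card_le_succ_pow_finrank_of_forall_exists_pos_iff
        (a := fun p : T × T => p.2.1 - p.1.1) fun t ht => ?_
      obtain ⟨y, rfl⟩ := (mem_filter.1 ht).2
      exact ⟨(dotProductBilin ℝ ℝ).flip y, fun p => by simp [pattern]⟩
    simpa using hP
  · refine ⟨_, mem_image_of_mem _ (mem_filter.2 ⟨mem_univ _, y, rfl⟩), fun s hs t ht => ?_⟩
    have hpattern := Function.invFun_eq (f := pattern) ⟨y, rfl⟩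
    simpa [pattern] using (Finset.ext_iff.1 hpattern (⟨s, hs⟩, ⟨t, ht⟩)).symm

end Representatives

section DecisionTrees

open Finset LinearDecisionTree

variable {n : ℕ} {H S T X Y : Finset (Fin n → ℝ)} {w x y : Fin n → ℝ} {q q' : ℕ}

theorem SameOrder.insert_of_sign_eq {T : Set (Fin n → ℝ)} (h : SameOrder T x y)
    (hw : ∀ t ∈ T, SignType.sign ((w - t) ⬝ᵥ x) = SignType.sign ((w - t) ⬝ᵥ y)) :
    SameOrder (insert w T) x y := by
  have hlt (t) (ht : t ∈ T) : w ⬝ᵥ x < t ⬝ᵥ x ↔ w ⬝ᵥ y < t ⬝ᵥ y := by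
    simpa [sub_dotProduct, sign_eq_neg_one_iff] using congrArg (· = -1) (hw t ht)
  have hgt (t) (ht : t ∈ T) : t ⬝ᵥ x < w ⬝ᵥ x ↔ t ⬝ᵥ y < w ⬝ᵥ y := by
    simpa [sub_dotProduct, sign_eq_one_iff] using congrArg (· = 1) (hw t ht)
  rintro s (rfl | hs) t (rfl | ht)
  exacts [by simp, hlt t ht, hgt s hs, h s hs t ht]

/-- All inputs in `X` order the linear forms in `T` in the same way. -/
def SameOrderOn (T : Set (Fin n → ℝ)) (X : Finset (Fin n → ℝ)) : Prop :=
  ∀ x ∈ X, ∀ y ∈ X, SameOrder T x y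

theorem SameOrderOn.mono {S T : Set (Fin n → ℝ)} (h : SameOrderOn T X) (hST : S ⊆ T)
    (hYX : Y ⊆ X) : SameOrderOn S Y :=
  fun x hx y hy => (h x (hYX hx) y (hYX hy)).mono hST

theorem SameOrderOn.insert_of_eq {T : Set (Fin n → ℝ)} {a : Fin n → ℝ} (h : SameOrderOn T X)
    (ha : a ∈ T) (hw : ∀ x ∈ X, w ⬝ᵥ x = a ⬝ᵥ x) : SameOrderOn (insert w T) X :=
  fun x hx y hy => (h x hx y hy).insert_of_sign_eq fun t ht => by
    simpa only [sub_dotProduct, hw x hx, hw y hy] using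
      (h x hx y hy).sign_sub_dotProduct_eq ha ht

theorem SameOrderOn.insert_of_lt_or_gt {T : Set (Fin n → ℝ)} (h : SameOrderOn T X)
    (hw : ∀ t ∈ T, (∀ x ∈ X, w ⬝ᵥ x < t ⬝ᵥ x) ∨ ∀ x ∈ X, t ⬝ᵥ x < w ⬝ᵥ x) :
    SameOrderOn (insert w T) X :=
  fun x hx y hy => (h x hx y hy).insert_of_sign_eq fun t ht => by
    simp only [sub_dotProduct]
    rcases hw t ht with hlt | hgt
    · rw [sign_neg (sub_neg.2 (hlt x hx)), sign_neg (sub_neg.2 (hlt y hy))]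
    · rw [sign_pos (sub_pos.2 (hgt x hx)), sign_pos (sub_pos.2 (hgt y hy))]

theorem log_two_add_le_log_two {a b j : ℕ} (ha : a ≠ 0) (h : 2 ^ j * a ≤ b) :
    Nat.log 2 a + j ≤ Nat.log 2 b := by
  refine Nat.le_log_of_pow_le one_lt_two (le_trans ?_ h)
  rw [pow_add, mul_comm]
  exact Nat.mul_le_mul_left _ (Nat.pow_log_le_self 2 ha)

/-- Some comparison decision tree for `H` is correct on the inputs in `X` and makes at most `q`
queries on each of them. -/
def Solvable (H X : Finset (Fin n → ℝ)) (q : ℕ) : Prop :=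
  ∃ T : LinearDecisionTree n (H → SignType), T.IsComparison H ∧
    ∀ x ∈ X, T.eval x = signVector H x ∧ T.numQueries x ≤ q

namespace Solvable

theorem mono (h : Solvable H X q) (hYX : Y ⊆ X) (hq : q ≤ q') : Solvable H Y q' := by
  obtain ⟨T, hT, hX⟩ := h
  exact ⟨T, hT, fun x hx => ⟨(hX x (hYX hx)).1, (hX x (hYX hx)).2.trans hq⟩⟩

theorem of_forall_signVector_eq (hX : ∀ x ∈ X, ∀ y ∈ X, signVector H x = signVector H y) :
    Solvable H X q := by
  rcases X.eq_empty_or_nonempty with rfl | ⟨x, hx⟩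
  · exact ⟨.leaf 0, trivial, by simp⟩
  · exact ⟨.leaf (signVector H x), trivial, fun y hy => ⟨hX x hx y hy, Nat.zero_le q⟩⟩

theorem empty : Solvable H ∅ q :=
  of_forall_signVector_eq (by simp)

open Classical in
theorem node {v : Fin n → ℝ} (hv : v ∈ H ∨ ∃ h' ∈ H, ∃ h'' ∈ H, v = h' - h'')
    (h : ∀ s, Solvable H {x ∈ X | SignType.sign (v ⬝ᵥ x) = s} q) : Solvable H X (q + 1) := by
  choose T hT hX using h
  refine ⟨.node v T, ⟨hv, hT⟩, fun x hx => ?_⟩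
  obtain ⟨heval, hnum⟩ := hX (SignType.sign (v ⬝ᵥ x)) x (mem_filter.2 ⟨hx, rfl⟩)
  exact ⟨heval, Nat.succ_le_succ hnum⟩

open Classical in
theorem compare {t : Fin n → ℝ} (hw : w ∈ H) (ht : t = 0 ∨ t ∈ H)
    (hlt : Solvable H {x ∈ X | w ⬝ᵥ x < t ⬝ᵥ x} q) (heq : Solvable H {x ∈ X | w ⬝ᵥ x = t ⬝ᵥ x} q)
    (hgt : Solvable H {x ∈ X | t ⬝ᵥ x < w ⬝ᵥ x} q) : Solvable H X (q + 1) := by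
  have hquery : w - t ∈ H ∨ ∃ h' ∈ H, ∃ h'' ∈ H, w - t = h' - h'' :=
    ht.elim (fun h => .inl (by simpa [h])) fun h => .inr ⟨w, hw, t, h, rfl⟩
  refine node hquery fun s => ?_
  cases s
  · simpa [sub_dotProduct, sub_eq_zero] using heq
  · simpa [sub_dotProduct, sign_eq_neg_one_iff] using hlt
  · simpa [sub_dotProduct, sign_eq_one_iff] using hgt

open Classical in
theorem compare_max (hw : w ∈ H) (hT : ∀ t ∈ T, t = 0 ∨ t ∈ H) (hX : SameOrderOn T X)
    (hlt : ∀ t ∈ T, Solvable H {x ∈ X | w ⬝ᵥ x < t ⬝ᵥ x} q)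
    (heq : ∀ t ∈ T, Solvable H {x ∈ X | w ⬝ᵥ x = t ⬝ᵥ x} q)
    (hgt : Solvable H {x ∈ X | ∀ t ∈ T, t ⬝ᵥ x < w ⬝ᵥ x} q) : Solvable H X (q + 1) := by
  rcases T.eq_empty_or_nonempty with rfl | hne
  · exact hgt.mono (fun x hx => by simp [hx]) q.le_succ
  rcases X.eq_empty_or_nonempty with rfl | ⟨x, hx⟩
  · exact empty
  obtain ⟨a, ha, hmax⟩ := T.exists_max_image (· ⬝ᵥ x) hne
  refine compare hw (hT a ha) (hlt a ha) (heq a ha) (hgt.mono (fun y hy => ?_) le_rfl)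
  rw [mem_filter] at hy ⊢
  exact ⟨hy.1, fun t ht => (((hX x hx y hy.1).le_iff ht ha).1 (hmax t ht)).trans_lt hy.2⟩

open Classical in
theorem compare_min (hw : w ∈ H) (hT : ∀ t ∈ T, t = 0 ∨ t ∈ H) (hX : SameOrderOn T X)
    (hgt : ∀ t ∈ T, Solvable H {x ∈ X | t ⬝ᵥ x < w ⬝ᵥ x} q)
    (heq : ∀ t ∈ T, Solvable H {x ∈ X | w ⬝ᵥ x = t ⬝ᵥ x} q)
    (hlt : Solvable H {x ∈ X | ∀ t ∈ T, w ⬝ᵥ x < t ⬝ᵥ x} q) : Solvable H X (q + 1) := by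
  rcases T.eq_empty_or_nonempty with rfl | hne
  · exact hlt.mono (fun x hx => by simp [hx]) q.le_succ
  rcases X.eq_empty_or_nonempty with rfl | ⟨x, hx⟩
  · exact empty
  obtain ⟨a, ha, hmin⟩ := T.exists_min_image (· ⬝ᵥ x) hne
  refine compare hw (hT a ha) (hlt.mono (fun y hy => ?_) le_rfl) (heq a ha) (hgt a ha)
  rw [mem_filter] at hy ⊢
  exact ⟨hy.1, fun t ht => hy.2.trans_le (((hX x hx y hy.1).le_iff ha ht).1 (hmin t ht))⟩

open Classical in
-- Compare `w` with the largest form below which at most half of the inputs put `w`, and then with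
-- the smallest of the remaining forms.
theorem of_insert_of_half (hw : w ∈ H) (hT : ∀ t ∈ T, t = 0 ∨ t ∈ H) (hX : SameOrderOn T X)
    (hhalf : ∀ Y ⊆ X, 2 * #Y ≤ #X → Solvable H Y q)
    (hins : ∀ Y ⊆ X, SameOrderOn (insert w ↑T) Y → Solvable H Y q) : Solvable H X (q + 2) := by
  have heq (Y) (hY : Y ⊆ X) (t) (ht : t ∈ T) : Solvable H {x ∈ Y | w ⬝ᵥ x = t ⬝ᵥ x} q :=
    have hYX := (filter_subset _ Y).trans hY
    hins _ hYX ((hX.mono subset_rfl hYX).insert_of_eq ht fun x hx => (mem_filter.1 hx).2)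
  let low : Finset (Fin n → ℝ) := {t ∈ T | 2 * #{x ∈ X | w ⬝ᵥ x < t ⬝ᵥ x} ≤ #X}
  have hlow : low ⊆ T := filter_subset _ _
  have hhigh : T \ low ⊆ T := sdiff_subset
  refine compare_max (q := q + 1) hw (fun t ht => hT t (hlow ht)) (hX.mono (by simpa) subset_rfl)
    (fun t ht => ?_) (fun t ht => ?_) ?_
  · exact (hhalf _ (filter_subset _ _) (mem_filter.1 ht).2).mono subset_rfl q.le_succ
  · exact (heq X subset_rfl t (hlow ht)).mono subset_rfl q.le_succ
  have hX' : {x ∈ X | ∀ t ∈ low, t ⬝ᵥ x < w ⬝ᵥ x} ⊆ X := filter_subset _ _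
  refine compare_min hw (fun t ht => hT t (hhigh ht)) (hX.mono (by simp) hX')
    (fun t ht => ?_) (fun t ht => heq _ hX' t (hhigh ht)) ?_
  · refine (hhalf {x ∈ X | ¬ w ⬝ᵥ x < t ⬝ᵥ x} (filter_subset _ _) ?_).mono
      (fun x hx => ?_) le_rfl
    · have hsum := card_filter_add_card_filter_not (s := X) fun x => w ⬝ᵥ x < t ⬝ᵥ x
      simp only [low, mem_sdiff, mem_filter] at ht
      grind
    · grind
  · refine hins _ ((filter_subset _ _).trans hX')
      ((hX.mono subset_rfl ((filter_subset _ _).trans hX')).insert_of_lt_or_gt fun t ht => ?_)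
    grind

theorem of_insert (hw : w ∈ H) (hT : ∀ t ∈ T, t = 0 ∨ t ∈ H) (hX : SameOrderOn T X)
    (hins : ∀ Y ⊆ X, SameOrderOn (insert w ↑T) Y → Solvable H Y (q + 2 * Nat.log 2 #Y)) :
    Solvable H X (q + 2 + 2 * Nat.log 2 #X) := by
  induction hc : #X using Nat.strong_induction_on generalizing X with
  | _ c ih =>
    subst hc
    suffices Solvable H X (q + 2 * Nat.log 2 #X + 2) from this.mono subset_rfl (by omega)
    refine of_insert_of_half hw hT hX (fun Y hYX hY => ?_) fun Y hYX hY => ?_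
    · rcases Y.eq_empty_or_nonempty with rfl | hne
      · exact empty
      have hlog := log_two_add_le_log_two (j := 1) hne.card_ne_zero hY
      refine (ih #Y ?_ (hX.mono subset_rfl hYX) (fun Z hZ => hins Z (hZ.trans hYX)) rfl).mono
        subset_rfl (by omega)
      have := hne.card_pos
      omega
    · have hlog := Nat.log_mono_right (b := 2) (card_le_card hYX)
      exact (hins Y hYX hY).mono subset_rfl (by omega)

theorem of_sort (hS : S ⊆ H)
    (hsort : ∀ Y ⊆ X, SameOrderOn (insert 0 ↑S) Y → Solvable H Y (q + 2 * Nat.log 2 #Y)) :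
    Solvable H X (q + 2 * #S + 2 * Nat.log 2 #X) := by
  classical
  induction S using Finset.induction_on generalizing q with
  | empty => exact hsort X subset_rfl fun x _ y _ => by simp [SameOrder]
  | insert w S hwS ih =>
    rw [insert_subset_iff] at hS
    suffices Solvable H X (q + 2 + 2 * #S + 2 * Nat.log 2 #X) from
      this.mono subset_rfl (by rw [card_insert_of_notMem hwS]; omega)
    refine ih hS.2 fun Y hYX hY => of_insert (T := insert 0 S) hS.1 (fun t ht => ?_)
      (by simpa using hY) fun Z hZY hZ => hsort Z (hZY.trans hYX) ?_
    · exact (mem_insert.1 ht).imp_right fun h => hS.2 h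
    · simpa [Set.insert_comm] using hZ

end Solvable

open Classical in
/-- The elements of `H` whose sign is not constant on `X`. -/
noncomputable def unresolved (H X : Finset (Fin n → ℝ)) : Finset (Fin n → ℝ) :=
  {h ∈ H | ∃ x ∈ X, ∃ y ∈ X, SignType.sign (h ⬝ᵥ x) ≠ SignType.sign (h ⬝ᵥ y)}

theorem unresolved_subset : unresolved H X ⊆ H := by
  classical exact filter_subset _ _

theorem unresolved_mono (hYX : Y ⊆ X) : unresolved H Y ⊆ unresolved H X := by
  classical
  exact monotone_filter_right H fun h _ ⟨x, hx, y, hy, hxy⟩ => ⟨x, hYX hx, y, hYX hy, hxy⟩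

theorem notMem_inferred_of_mem_unresolved {h : Fin n → ℝ} (hX : SameOrderOn (insert 0 ↑S) X)
    (hx : x ∈ X) (hh : h ∈ unresolved H X) : h ∉ inferred x S := by
  classical
  obtain ⟨-, y, hy, z, hz, hyz⟩ := mem_filter.1 hh
  exact fun hi => hyz <| (hi y (hX x hx y hy)).symm.trans (hi z (hX x hx z hz))

open Classical in
theorem two_mul_card_unresolved_le (hX : SameOrderOn (insert 0 ↑S) Y) (hYX : Y ⊆ X) (hy : y ∈ Y)
    (hhalf : #(unresolved H X) < 2 * #{h ∈ unresolved H X | h ∈ inferred y S}) :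
    2 * #(unresolved H Y) ≤ #(unresolved H X) := by
  have hsub : unresolved H Y ⊆ {h ∈ unresolved H X | h ∉ inferred y S} := fun h hh =>
    mem_filter.2 ⟨unresolved_mono hYX hh, notMem_inferred_of_mem_unresolved hX hy hh⟩
  have hle := card_le_card hsub
  have hsum := card_filter_add_card_filter_not (s := unresolved H X) (· ∈ inferred y S)
  omega

namespace Solvable

theorem of_unresolved_eq_empty (h : unresolved H X = ∅) : Solvable H X q := by
  classical
  refine of_forall_signVector_eq fun x hx y hy => funext fun a => ?_
  by_contra hne
  exact filter_eq_empty_iff.1 h a.2 ⟨x, hx, y, hy, hne⟩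

-- Sort a sample of the unresolved forms. An input order either infers at least half of the
-- unresolved forms, or belongs to a set of inputs that is smaller by a factor `2 ^ (3 * d)`, which
-- repays the cost of sorting.
theorem of_halving {d : ℕ} (hd : 0 < d) (hH : ∀ x, InferenceDimLE (inferred x) H d)
    (hne : (unresolved H X).Nonempty)
    (hhalf : ∀ Y ⊆ X, 2 * #(unresolved H Y) ≤ #(unresolved H X) →
      Solvable H Y (q + 13 * Nat.log 2 #Y))
    (hfew : ∀ Y ⊆ X, #Y < #X → Solvable H Y (q + 32 * d + 13 * Nat.log 2 #Y)) :
    Solvable H X (q + 32 * d + 13 * Nat.log 2 #X) := by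
  obtain ⟨S, hS, hScard, hfail⟩ := exists_sample (X := X) hne monotone_inferred subset_inferred
    fun x => (hH x).subset unresolved_subset
  suffices Solvable H X (q + 11 * Nat.log 2 #X + 2 * #S + 2 * Nat.log 2 #X) from
    this.mono subset_rfl (by omega)
  refine of_sort (hS.trans unresolved_subset) fun Y hYX hY => ?_
  have hlog := Nat.log_mono_right (b := 2) (card_le_card hYX)
  rcases Y.eq_empty_or_nonempty with rfl | hYne
  · exact empty
  by_cases hgood : ∃ y ∈ Y,
      #(unresolved H X) < 2 * #{h ∈ unresolved H X | h ∈ inferred y S}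
  · obtain ⟨y, hy, hlt⟩ := hgood
    exact (hhalf Y hYX (two_mul_card_unresolved_le hY hYX hy hlt)).mono subset_rfl (by omega)
  · push Not at hgood
    have hYle : 2 ^ (3 * d) * #Y ≤ #X := (Nat.mul_le_mul_left _ <| card_le_card fun y hy =>
      mem_filter.2 ⟨hYX hy, hgood y hy⟩).trans hfail
    have hYlog := log_two_add_le_log_two hYne.card_ne_zero hYle
    have hYlt : #Y < #X := lt_of_lt_of_le
      (lt_mul_of_one_lt_left hYne.card_pos (Nat.one_lt_two_pow (by omega))) hYle
    exact (hfew Y hYX hYlt).mono subset_rfl (by omega)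

theorem of_inferenceDimLE {d k : ℕ} (hd : 0 < d) (hH : ∀ x, InferenceDimLE (inferred x) H d)
    (hk : #(unresolved H X) < 2 ^ k) : Solvable H X (32 * d * k + 13 * Nat.log 2 #X) := by
  induction k generalizing X with
  | zero => exact of_unresolved_eq_empty (by simpa using hk)
  | succ k ihk =>
    induction hc : #X using Nat.strong_induction_on generalizing X with
    | _ c ihX =>
      subst hc
      rcases (unresolved H X).eq_empty_or_nonempty with hempty | hne
      · exact of_unresolved_eq_empty hempty
      · exact of_halving hd hH hne (fun Y _ hY => ihk (by rw [pow_succ] at hk; omega))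
          fun Y hYX hY => ihX #Y hY ((card_le_card (unresolved_mono hYX)).trans_lt hk) rfl

end Solvable

theorem SameOrder.signVector_eq (h : SameOrder (insert 0 ↑H) x y) :
    signVector H x = signVector H y :=
  funext fun a => h.sign_dotProduct_eq (.inr a.2) (.inl rfl)

theorem SameOrder.eval_eq_and_numQueries_eq {α : Type} (h : SameOrder (insert 0 ↑H) x y)
    {T : LinearDecisionTree n α} (hT : T.IsComparison H) :
    T.eval x = T.eval y ∧ T.numQueries x = T.numQueries y := by
  induction T with
  | leaf => exact ⟨rfl, rfl⟩
  | node v next ih =>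
    have hv : SignType.sign (v ⬝ᵥ x) = SignType.sign (v ⬝ᵥ y) := by
      obtain ⟨hv | ⟨s, hs, t, ht, rfl⟩, -⟩ := hT
      exacts [h.sign_dotProduct_eq (.inr hv) (.inl rfl),
        h.sign_sub_dotProduct_eq (.inr hs) (.inr ht)]
    obtain ⟨heval, hnum⟩ := ih (SignType.sign (v ⬝ᵥ y)) (hT.2 _)
    simp only [eval, numQueries, hv, heval, hnum, and_self]

theorem exists_isComparison_computes_signVector {d k : ℕ} (hd : 0 < d)
    (hH : ∀ x, InferenceDimLE (inferred x) H d) (hk : #H < 2 ^ k) :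
    ∃ T : LinearDecisionTree n (H → SignType), T.IsComparison H ∧ T.Computes (signVector H) ∧
      ∀ x, T.numQueries x ≤ 32 * d * k + 13 * (n * (2 * k + 1)) := by
  classical
  obtain ⟨X, hXcard, hX⟩ := exists_sameOrder_representatives (insert 0 H)
  have hXlog : Nat.log 2 #X ≤ n * (2 * k + 1) := by
    have hbase : #(insert 0 H) * #(insert 0 H) + 1 ≤ 2 ^ (2 * k + 1) := by
      have hins := (card_insert_le 0 H).trans hk
      have hpos := Nat.one_le_two_pow (n := 2 * k)
      calc _ ≤ 2 ^ k * 2 ^ k + 1 := by gcongr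
        _ ≤ _ := by rw [pow_succ, two_mul k, pow_add] at *; omega
    refine (Nat.log_mono_right (hXcard.trans (Nat.pow_le_pow_left hbase n))).trans ?_
    rw [← pow_mul, Nat.log_pow one_lt_two, mul_comm]
  obtain ⟨T, hT, hTX⟩ := Solvable.of_inferenceDimLE (X := X) hd hH
    ((card_le_card unresolved_subset).trans_lt hk)
  have htree (y) : T.eval y = signVector H y ∧
      T.numQueries y ≤ 32 * d * k + 13 * Nat.log 2 #X := by
    obtain ⟨x, hx, hyx⟩ := hX y
    rw [coe_insert] at hyx
    obtain ⟨heval, hnum⟩ := hyx.eval_eq_and_numQueries_eq hT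
    rw [heval, hnum, hyx.signVector_eq]
    exact hTX x hx
  exact ⟨T, hT, fun y => (htree y).1, fun y => (htree y).2.trans (by gcongr)⟩

end DecisionTrees

theorem exists_lt_two_pow_and_le_log {y : ℝ} (hy : 2 ≤ y) :
    ∃ k : ℕ, 0 < k ∧ y < 2 ^ k ∧ (k : ℝ) ≤ 3 * Real.log y := by
  have hlog2 : 2 / 3 < Real.log 2 := by linarith [Real.log_two_gt_d9]
  have hlog : Real.log 2 ≤ Real.log y := Real.log_le_log two_pos hy
  refine ⟨⌊Real.logb 2 y⌋₊ + 1, Nat.succ_pos _, ?_, ?_⟩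
  · rw [← Real.rpow_natCast, ← Real.logb_lt_iff_lt_rpow one_lt_two (by linarith)]
    exact_mod_cast Nat.lt_floor_add_one _
  · have hfloor : (⌊Real.logb 2 y⌋₊ : ℝ) * Real.log 2 ≤ Real.log y := by
      rw [← le_div_iff₀ (by linarith)]
      exact Nat.floor_le (Real.logb_nonneg one_lt_two (by linarith))
    push_cast
    nlinarith

theorem pow_lt_two_pow_of_mul_lt_two_pow {n k : ℕ} {w : ℝ} (hn : n ≠ 0) (hk : k ≠ 0) (hw : 0 ≤ w)
    (h : n * w < 2 ^ k) : (4 * w * (8 * n * k : ℕ) + 1) ^ n < (2 : ℝ) ^ (8 * n * k) := by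
  have hk2 : (k : ℝ) + 1 ≤ 2 ^ k := by exact_mod_cast Nat.lt_two_pow_self
  have h2 : (2 : ℝ) ^ 6 ≤ (2 ^ k) ^ 6 :=
    pow_le_pow_left₀ zero_le_two (le_self_pow₀ one_le_two hk) 6
  have hbase : 4 * w * (8 * n * k : ℕ) + 1 < (2 : ℝ) ^ (8 * k) := by
    calc 4 * w * (8 * n * k : ℕ) + 1 = 32 * ((n * w) * k) + 1 := by push_cast; ring
      _ < 2 ^ 6 * (2 ^ k * 2 ^ k) := by nlinarith [show (0 : ℝ) ≤ n * w by positivity]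
      _ ≤ (2 ^ k) ^ 6 * (2 ^ k * 2 ^ k) := by gcongr
      _ = 2 ^ (8 * k) := by rw [mul_comm 8 k, pow_mul]; ring
  calc _ < ((2 : ℝ) ^ (8 * k)) ^ n := pow_lt_pow_left₀ hbase (by positivity) hn
    _ = 2 ^ (8 * n * k) := by rw [← pow_mul]; ring_nf

/-- The norm on `Fin n → ℝ` is the sup norm. -/
theorem mainTheorem1 :
    ∃ C : ℝ, 0 < C ∧
      ∀ (n : ℕ) (w : ℝ) (H : Finset (Fin n → ℝ)),
        (∀ h ∈ H, ∀ i, ∃ k : ℤ, h i = (k : ℝ)) →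
        (∀ h ∈ H, ‖h‖ ≤ w) →
        2 ≤ (n : ℝ) * w →
        2 ≤ H.card →
        ∃ T : LinearDecisionTree n (H → SignType),
          T.IsComparison H ∧
          T.Computes (signVector H) ∧
          T.QueryComplexityLE
            (C * ((n : ℝ) * Real.log ((n : ℝ) * w) * Real.log (H.card : ℝ))) := by
  refine ⟨4959, by norm_num, fun n w H hint hnorm hnw hcard => ?_⟩
  have hn : n ≠ 0 := by rintro rfl; norm_num at hnw
  have hw : 0 ≤ w := by
    obtain ⟨h, hh⟩ := Finset.card_pos.1 (by omega : 0 < H.card)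
    exact (norm_nonneg h).trans (hnorm h hh)
  obtain ⟨k, hk0, hk, hklog⟩ := exists_lt_two_pow_and_le_log hnw
  obtain ⟨l, hl0, hl, hllog⟩ := exists_lt_two_pow_and_le_log (y := H.card) (by exact_mod_cast hcard)
  have hdim := inferenceDimLE_inferred hw (pow_lt_two_pow_of_mul_lt_two_pow hn hk0.ne' hw hk)
    hint hnorm
  obtain ⟨T, hT, hcomp, hnum⟩ :=
    exists_isComparison_computes_signVector (by positivity) hdim (by exact_mod_cast hl)
  refine ⟨T, hT, hcomp, fun x => ?_⟩
  calc (T.numQueries x : ℝ) ≤ (551 * n * k * l : ℕ) := by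
        refine mod_cast (hnum x).trans ?_
        nlinarith [Nat.mul_le_mul_left n hk0, Nat.mul_le_mul_left n hl0]
    _ = 551 * (n * (k * l)) := by push_cast; ring
    _ ≤ 551 * (n * (3 * Real.log (n * w) * (3 * Real.log H.card))) := by
      have := k.cast_nonneg.trans hklog
      gcongr
    _ = 4959 * (n * Real.log (n * w) * Real.log H.card) := by ring
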